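/- All graphs are finite, simple and undirected. For a vertex $v$ of a graph $G$, \emph{local complementation} (LC) on $v$ transforms $G$ into $G*v$ by replacing the subgraph of $G$ induced on the neighborhood $N_v$ of $v$ by its complement. For an edge $\{u,v\}$ of $G$, \emph{edge local complementation} (ELC) on $\{u,v\}$ transforms $G$ into $G*u*v*u$. A graph $G$ is \emph{ELC-preserved} if for every edge $\{u,v\}$ of $G$ the graph $G*u*v*u$ is isomorphic to $G$. Let $r\ge 3$. Let $h^r$ be the bipartite graph on $2^r-1$ vertices with one part consisting of $r$ vertices $u_1,\dots,u_r$ and the other part $W$ consisting of one vertex $w_S$ for each subset $S\subseteq\{1,\dots,r\}$ with $|S|\ge 2$, where $u_i$ and $w_S$ are adjacent if and only if $i\in S$. Let $h^r_e$ be obtained from $h^r$ by adding one new vertex $u_e$, adjacent to exactly those vertices that have even degree in $h^r$. Put $U=\{u_1,\dots,u_r,u_e\}$. \textbf{Theorem.} Let $r\ge 3$. The graph $h^r_e$ is bipartite with parts $U$ and $W$, where $|U|=r+1$ and $|W|=2^r-r-1$. Moreover: \begin{enumerate} \item Applying LC successively to all vertices of $W$ (once each), in any order, leaves $h^r_e$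 unchanged. \item Applying LC successively to all vertices of $U$ (once each), in any order, transforms $h^r_e$ into a graph $h^r_*$ that does not depend on the order and is ELC-preserved. If $r\ge 4$, then $h^r_*$ is non-bipartite. \end{enumerate} -/

import Mathlib

/-- Local complementation `G * v`: the subgraph induced on the neighborhood of `v` is replaced by
its complement, and all other pairs are left as they are. -/
def localComplement {V : Type*} (G : SimpleGraph V) (v : V) : SimpleGraph V where
  Adj x y :=
    ((G.Adj v x ∧ G.Adj v y) ∧ x ≠ y ∧ ¬ G.Adj x y) ∨ (¬ (G.Adj v x ∧ G.Adj v y) ∧ G.Adj x y)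
  symm := ⟨fun x y h => by
    rcases h with ⟨⟨hx, hy⟩, hne, hn⟩ | ⟨hn, h⟩
    · exact Or.inl ⟨⟨hy, hx⟩, hne.symm, fun h => hn h.symm⟩
    · exact Or.inr ⟨fun h' => hn ⟨h'.2, h'.1⟩, h.symm⟩⟩
  loopless := ⟨fun x h => by
    rcases h with ⟨_, hne, _⟩ | ⟨_, h⟩
    · exact hne rfl
    · exact G.loopless.irrefl x h⟩

/-- Local complementations applied one after the other: `G * v₁ * v₂ * ⋯ * vₖ`. -/
def localComplementList {V : Type*} (G : SimpleGraph V) (l : List V) : SimpleGraph V :=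
  l.foldl localComplement G

/-- Edge local complementation `G * u * v * u` (applied to edges `{u, v}` of `G`). -/
def edgeLocalComplement {V : Type*} (G : SimpleGraph V) (u v : V) : SimpleGraph V :=
  localComplement (localComplement (localComplement G u) v) u

/-- A graph is ELC-preserved if edge local complementation on any of its edges gives a graph
isomorphic to it. -/
def ELCPreserved {V : Type*} (G : SimpleGraph V) : Prop :=
  ∀ u v : V, G.Adj u v → Nonempty (edgeLocalComplement G u v ≃g G)

/-- `l` lists every element of `s` exactly once. -/
def IsOrdering {V : Type*} (s : Finset V) (l : List V) : Prop :=
  l.Nodup ∧ ∀ v, v ∈ l ↔ v ∈ s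

/-- The vertices of the Hamming graph: `r` vertices, and one vertex for every set of at least
two of them (which will be its neighborhood). -/
abbrev HammingVertex (r : ℕ) : Type :=
  Fin r ⊕ {s : Finset (Fin r) // 2 ≤ s.card}

/-- The graph `h^r`. -/
def hammingGraph (r : ℕ) : SimpleGraph (HammingVertex r) where
  Adj
    | Sum.inl i, Sum.inr s => i ∈ s.1
    | Sum.inr s, Sum.inl i => i ∈ s.1
    | _, _ => False
  symm := ⟨by rintro (i | s) (j | t) h <;> exact h⟩
  loopless := ⟨by rintro (i | s) h <;> exact h⟩

instance hammingGraphDecidable (r : ℕ) : DecidableRel (hammingGraph r).Adj := by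
  rintro (i | s) (j | t)
  · exact inferInstanceAs (Decidable False)
  · exact inferInstanceAs (Decidable (i ∈ t.1))
  · exact inferInstanceAs (Decidable (j ∈ s.1))
  · exact inferInstanceAs (Decidable False)

/-- The graph `h^r_e`: a new vertex `none` is added to `h^r` and joined to all vertices that have
even degree in `h^r`. -/
def extHammingGraph (r : ℕ) : SimpleGraph (Option (HammingVertex r)) where
  Adj
    | some x, some y => (hammingGraph r).Adj x y
    | none, some y => Even ((hammingGraph r).degree y)
    | some x, none => Even ((hammingGraph r).degree x)
    | none, none => False
  symm := ⟨by
    rintro (_ | x) (_ | y) h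
    · exact h
    · exact h
    · exact h
    · exact (hammingGraph r).symm.symm x y h⟩
  loopless := ⟨by
    rintro (_ | x) h
    · exact h
    · exact (hammingGraph r).loopless.irrefl x h⟩

/-- The first part of `h^r_e`: the `r` original vertices together with the new vertex. -/
def extHammingU (r : ℕ) : Finset (Option (HammingVertex r)) :=
  insert none (Finset.univ.image fun i : Fin r => some (Sum.inl i))

/-- The second part of `h^r_e`: the vertices that stand for sets of size at least two. -/
def extHammingW (r : ℕ) : Finset (Option (HammingVertex r)) :=
  Finset.univ.image fun s : {s : Finset (Fin r) // 2 ≤ s.card} => some (Sum.inr s)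

/-! ### Local complementation as arithmetic on adjacency matrices over `ZMod 2`. -/

section LocalComplement

variable {V : Type*}

/-! Label the vertices of $h^r_e$ by the odd-weight vectors of $\mathbb F_2^{r+1}$
(`hammingVector`): the vertices of $U$ become the unit vectors, and the coordinates of a vertex of
$W$ record its neighbours in $U$. LC at $v$ adds $A_{vx}A_{vy}$ to each off-diagonal entry $A_{xy}$,
and over an independent set these changes simply add up.

Over $W$, the change between $u_i$ and $u_j$ is the scalar product of two distinct coordinate
functions on $W$, which vanishes (`sum_wVertex_mul`). Over $U$, the change between two vertices of
$W$ is the dot product of their vectors. Hence $h^r_*$ is the graph on all odd vectors in which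
distinct vectors are adjacent when their dot product is 1.

Odd vectors satisfy $x\cdot x=1$, so ELC on $uv$ replaces the dot product by $x\cdot y+(u\cdot
x)(v\cdot y)+(v\cdot x)(u\cdot y)$ without exceptions at $u$ and $v$. The linear involution
`pivotMap` carries this form back to the dot product, giving the isomorphism. For $r\ge4$ there is a
triangle. -/

open Classical in
/-- The adjacency matrix of `G` over `ZMod 2`. -/
noncomputable def adjZ (G : SimpleGraph V) (x y : V) : ZMod 2 := if G.Adj x y then 1 else 0

lemma adjZ_eq_one {G : SimpleGraph V} {x y : V} : adjZ G x y = 1 ↔ G.Adj x y := by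
  unfold adjZ; split_ifs with h <;> simp [h]

lemma adjZ_eq_zero {G : SimpleGraph V} {x y : V} : adjZ G x y = 0 ↔ ¬ G.Adj x y := by
  unfold adjZ; split_ifs with h <;> simp [h]

@[simp] lemma adjZ_self (G : SimpleGraph V) (x : V) : adjZ G x x = 0 := by simp [adjZ]

lemma adjZ_comm (G : SimpleGraph V) (x y : V) : adjZ G x y = adjZ G y x := by
  unfold adjZ
  by_cases h : G.Adj x y
  · rw [if_pos h, if_pos h.symm]
  · rw [if_neg h, if_neg fun h' => h h'.symm]

lemma eq_of_adjZ {G H : SimpleGraph V} (h : ∀ x y, x ≠ y → adjZ G x y = adjZ H x y) : G = H := by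
  ext x y
  by_cases hxy : x = y
  · subst hxy; simp
  · rw [← adjZ_eq_one, ← adjZ_eq_one, h x y hxy]

lemma adjZ_localComplement (G : SimpleGraph V) (v : V) {x y : V} (hxy : x ≠ y) :
    adjZ (localComplement G v) x y = adjZ G x y + adjZ G v x * adjZ G v y := by
  unfold adjZ
  simp only [localComplement]
  by_cases h1 : G.Adj v x <;> by_cases h2 : G.Adj v y <;> by_cases h3 : G.Adj x y <;>
    simp [h1, h2, h3, hxy, CharTwo.add_self_eq_zero]

lemma adjZ_localComplement_left (G : SimpleGraph V) {u v : V} (huv : ¬ G.Adj v u) (x : V) :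
    adjZ (localComplement G v) u x = adjZ G u x := by
  by_cases hux : u = x
  · subst hux; simp
  · rw [adjZ_localComplement G v hux, adjZ_eq_zero.2 huv]; simp

/-- Local complementation on pairwise non-adjacent vertices adds up the changes. -/
lemma adjZ_localComplementList (l : List V) (G : SimpleGraph V)
    (hl : ∀ u ∈ l, ∀ v ∈ l, ¬ G.Adj u v) {x y : V} (hxy : x ≠ y) :
    adjZ (localComplementList G l) x y =
      adjZ G x y + (l.map fun v => adjZ G v x * adjZ G v y).sum := by
  induction l generalizing G with
  | nil => simp [localComplementList]
  | cons a l ih =>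
    -- LC at `a` does not affect the rows of non-neighbours of `a`, so the later vertices still act
    -- with their original neighbourhoods.
    have key : ∀ u ∈ l, ∀ z, adjZ (localComplement G a) u z = adjZ G u z := fun u hu z =>
      adjZ_localComplement_left G (hl a (by simp) u (by simp [hu])) z
    have h := ih (localComplement G a) (fun u hu v hv => by
      rw [← adjZ_eq_zero, key u hu, adjZ_eq_zero]
      exact hl u (by simp [hu]) v (by simp [hv]))
    have hs : (l.map fun v => adjZ (localComplement G a) v x * adjZ (localComplement G a) v y) =
        l.map fun v => adjZ G v x * adjZ G v y :=
      List.map_congr_left fun v hv => by rw [key v hv, key v hv]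
    rw [hs, adjZ_localComplement G a hxy] at h
    change adjZ (localComplementList (localComplement G a) l) x y = _
    rw [h, List.map_cons, List.sum_cons, add_assoc]

lemma adjZ_localComplementList_of_isOrdering [DecidableEq V] {G : SimpleGraph V} {s : Finset V}
    (hs : ∀ u ∈ s, ∀ v ∈ s, ¬ G.Adj u v) {l : List V} (hl : IsOrdering s l) {x y : V}
    (hxy : x ≠ y) :
    adjZ (localComplementList G l) x y = adjZ G x y + ∑ v ∈ s, adjZ G v x * adjZ G v y := by
  have hls : s = l.toFinset := by ext v; simp [hl.2]
  rw [adjZ_localComplementList l G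
    (fun u hu v hv => hs u ((hl.2 u).1 hu) v ((hl.2 v).1 hv)) hxy, hls,
    List.sum_toFinset _ hl.1]

/-- Edge local complementation expressed through a form that agrees with adjacency off the diagonal
and is `1` on the diagonal. -/
lemma adjZ_edgeLocalComplement {G : SimpleGraph V} {b : V → V → ZMod 2}
    (hb : ∀ x y, x ≠ y → adjZ G x y = b x y) (hd : ∀ x, b x x = 1) {u v : V} (huv : G.Adj u v)
    {x y : V} (hxy : x ≠ y) :
    adjZ (edgeLocalComplement G u v) x y = b x y + (b u x * b v y + b v x * b u y) := by
  classical
  have hne : u ≠ v := huv.ne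
  have hsymm : ∀ x y, b x y = b y x := fun x y => by
    by_cases h : x = y
    · rw [h]
    · rw [← hb x y h, ← hb y x (Ne.symm h), adjZ_comm]
  have huv1 : b u v = 1 := by rw [← hb u v hne, adjZ_eq_one.2 huv]
  have hvu1 : b v u = 1 := by rw [hsymm, huv1]
  have h2 : (2 : ZMod 2) = 0 := rfl
  have e1 : ∀ x y, x ≠ y → adjZ (localComplement G u) x y =
      b x y + (if x = u then 0 else b u x) * (if y = u then 0 else b u y) := by
    intro x y h
    rw [adjZ_localComplement G u h, hb x y h]
    congr 2
    · split_ifs with hx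
      · simp [hx]
      · exact hb u x (Ne.symm hx)
    · split_ifs with hx
      · simp [hx]
      · exact hb u y (Ne.symm hx)
  have e2 : ∀ x, adjZ (localComplement G u) v x =
      if x = v then 0 else if x = u then 1 else b v x + b u x := by
    intro x
    split_ifs with h1 h3
    · simp [h1]
    · rw [h3, e1 v u hne.symm]; simp [hvu1]
    · rw [e1 v x (Ne.symm h1)]; simp [hne.symm, h3, huv1]
  have e3 : ∀ x, adjZ (localComplement (localComplement G u) v) u x =
      if x = u then 0 else if x = v then 1 else b v x := by
    intro x
    split_ifs with h1 h3
    · simp [h1]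
    · rw [h3, adjZ_localComplement _ v hne, e1 u v hne]; simp [huv1]
    · rw [adjZ_localComplement _ v (Ne.symm h1), e1 u x (Ne.symm h1), e2, e2]
      simp only [hne, h1, h3, if_true, if_false]
      linear_combination (b u x) * h2
  unfold edgeLocalComplement
  rw [adjZ_localComplement _ u hxy, adjZ_localComplement _ v hxy, e1 x y hxy, e2, e2, e3, e3]
  -- ELC also exchanges the roles of `u` and `v`. The diagonal value 1 absorbs this: at `x = u` the
  -- formula reduces to `b v y`.
  by_cases hxu : x = u
  · subst hxu
    by_cases hyv : y = v
    · subst hyv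
      simp only [hne, hne.symm, if_true, if_false, huv1, hvu1, hd]
      linear_combination -h2
    · simp only [hxy.symm, hyv, hne, if_true, if_false, hvu1, hd]
      ring
  by_cases hxv : x = v
  · subst hxv
    by_cases hyu : y = u
    · subst hyu
      simp only [hne, hne.symm, if_true, if_false, huv1, hvu1, hd]
      linear_combination -h2
    · simp only [hxy.symm, hyu, hxu, if_true, if_false, huv1, hd]
      ring
  by_cases hyu : y = u
  · subst hyu
    simp only [hxy, hne, hxv, if_true, if_false, hsymm x y, hvu1, hd]
    ring
  by_cases hyv : y = v
  · subst hyv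
    simp only [hxy, hne.symm, hxu, if_true, if_false, hsymm x y, huv1, hd]
    ring
  simp only [hxu, hxv, hyu, hyv, if_false]
  linear_combination (b u x * b u y + b v x * b v y) * h2

end LocalComplement

/-! ### The dot product on odd vectors and its graph. -/

section OddVector

variable {ι : Type*} [Fintype ι]

/-- The vectors over `ZMod 2` with coordinate sum `1`. -/
abbrev OddVector (ι : Type*) [Fintype ι] : Type _ := {x : ι → ZMod 2 // ∑ i, x i = 1}

lemma zmodTwo_mul_self (a : ZMod 2) : a * a = a := by revert a; decide

lemma dotProduct_self_zmodTwo (x : ι → ZMod 2) : x ⬝ᵥ x = ∑ i, x i := by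
  simp [dotProduct, zmodTwo_mul_self]

lemma dotProduct_mul_left_self (u v : ι → ZMod 2) : u ⬝ᵥ (u * v) = u ⬝ᵥ v := by
  simp [dotProduct, ← mul_assoc, zmodTwo_mul_self]

lemma dotProduct_mul_right_self (u v : ι → ZMod 2) : v ⬝ᵥ (u * v) = u ⬝ᵥ v := by
  rw [mul_comm, dotProduct_mul_left_self, dotProduct_comm]

lemma dotProduct_mul_mul_self (u v : ι → ZMod 2) : (u * v) ⬝ᵥ (u * v) = u ⬝ᵥ v := by
  simp [dotProduct, zmodTwo_mul_self]

omit [Fintype ι] in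
lemma add_self_zmodTwo (x : ι → ZMod 2) : x + x = 0 := by
  funext i
  exact CharTwo.add_self_eq_zero (x i)

/-- A linear isometry from the form obtained by pivoting on `u` and `v` to the dot product. -/
def pivotMap (u v x : ι → ZMod 2) : ι → ZMod 2 :=
  x + ((x ⬝ᵥ v) • (u + u * v) + (x ⬝ᵥ (u * v)) • (v + u * v))

section

variable {u v : ι → ZMod 2} (hu : u ⬝ᵥ u = 1) (hv : v ⬝ᵥ v = 1) (huv : u ⬝ᵥ v = 1)

include hu hv huv

/-- With $w=u*v$, all dot products among $u,v,w$ equal 1, so $u+w$ and $v+w$ span a totally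
isotropic space. Only the terms linear in the corrections survive, and those involving $w$ cancel in
pairs. -/
lemma pivotMap_dotProduct (x y : ι → ZMod 2) :
    pivotMap u v x ⬝ᵥ pivotMap u v y =
      x ⬝ᵥ y + ((u ⬝ᵥ x) * (v ⬝ᵥ y) + (v ⬝ᵥ x) * (u ⬝ᵥ y)) := by
  have h2 : (2 : ZMod 2) = 0 := rfl
  have huw := dotProduct_mul_left_self u v
  have hvw := dotProduct_mul_right_self u v
  have hww := dotProduct_mul_mul_self u v
  rw [huv] at huw hvw hww
  unfold pivotMap
  generalize u * v = w at *
  simp only [add_dotProduct, dotProduct_add, smul_dotProduct, dotProduct_smul, smul_eq_mul, hu, hv,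
    huv, huw, hvw, hww, dotProduct_comm w u, dotProduct_comm w v, dotProduct_comm v u,
    dotProduct_comm u y, dotProduct_comm v y, dotProduct_comm w y, dotProduct_comm u x,
    dotProduct_comm v x]
  generalize x ⬝ᵥ u = a
  generalize x ⬝ᵥ v = b
  generalize x ⬝ᵥ w = c
  generalize y ⬝ᵥ u = d
  generalize y ⬝ᵥ v = e
  generalize y ⬝ᵥ w = f
  generalize x ⬝ᵥ y = g
  -- What remains is an identity in seven scalars of `ZMod 2`, checked by exhaustion.
  ring_nf
  revert a b c d e f g
  decide

-- The corrections $u+w$ and $v+w$ are orthogonal to $v$ and $w$, so the coefficients $x\cdot v$ and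
-- $x\cdot w$ are unchanged and the same vector is added twice.
omit hu in
lemma pivotMap_pivotMap (x : ι → ZMod 2) : pivotMap u v (pivotMap u v x) = x := by
  have huw := dotProduct_mul_left_self u v
  have hvw := dotProduct_mul_right_self u v
  have hww := dotProduct_mul_mul_self u v
  rw [huv] at huw hvw hww
  have h11 : (1 : ZMod 2) + 1 = 0 := rfl
  have h1 : pivotMap u v x ⬝ᵥ v = x ⬝ᵥ v := by
    simp only [pivotMap, add_dotProduct, smul_dotProduct, hv, huv, dotProduct_comm (u * v) v, hvw,
      h11, smul_zero, add_zero]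
  have h3 : pivotMap u v x ⬝ᵥ (u * v) = x ⬝ᵥ (u * v) := by
    simp only [pivotMap, add_dotProduct, smul_dotProduct, huw, hvw, hww, h11, smul_zero, add_zero]
  rw [pivotMap, h1, h3, pivotMap, add_assoc, add_self_zmodTwo, add_zero]

end

/-- The graph on a set of odd vectors in which different vectors are adjacent if their dot product
is `1`. -/
def oddVectorGraph {V : Type*} (f : V ≃ OddVector ι) : SimpleGraph V where
  Adj x y := x ≠ y ∧ (f x).1 ⬝ᵥ (f y).1 = 1
  symm := ⟨fun x y h => ⟨h.1.symm, by rw [dotProduct_comm]; exact h.2⟩⟩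
  loopless := ⟨fun _ h => h.1 rfl⟩

lemma zmodTwo_eq_of_iff {a b : ZMod 2} (h : a = 1 ↔ b = 1) : a = b := by
  revert a b; decide

lemma adjZ_oddVectorGraph {V : Type*} (f : V ≃ OddVector ι) {x y : V} (hxy : x ≠ y) :
    adjZ (oddVectorGraph f) x y = (f x).1 ⬝ᵥ (f y).1 :=
  zmodTwo_eq_of_iff (by rw [adjZ_eq_one]; simp [oddVectorGraph, hxy])

lemma OddVector.dotProduct_self (x : OddVector ι) : x.1 ⬝ᵥ x.1 = 1 := by
  rw [dotProduct_self_zmodTwo, x.2]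

theorem elcPreserved_oddVectorGraph {V : Type*} (f : V ≃ OddVector ι) :
    ELCPreserved (oddVectorGraph f) := by
  intro u v huv
  have hu := (f u).dotProduct_self
  have hv := (f v).dotProduct_self
  have h1 : (f u).1 ⬝ᵥ (f v).1 = 1 := huv.2
  have hdot := pivotMap_dotProduct hu hv h1
  have hinv := pivotMap_pivotMap hv h1
  -- The coordinate sum is the self dot product, and for `y = x` the two extra terms of the form
  -- coincide and cancel.
  have hodd : ∀ x : OddVector ι, ∑ i, pivotMap (f u).1 (f v).1 x.1 i = 1 := fun x => by
    rw [← dotProduct_self_zmodTwo, hdot, x.dotProduct_self, mul_comm, CharTwo.add_self_eq_zero,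
      add_zero]
  let φ : Equiv.Perm (OddVector ι) := Function.Involutive.toPerm
    (fun x => ⟨pivotMap (f u).1 (f v).1 x.1, hodd x⟩) (fun x => Subtype.ext (hinv x.1))
  let ψ : Equiv.Perm V := (f.trans φ).trans f.symm
  have hψ : ∀ x, (f (ψ x)).1 = pivotMap (f u).1 (f v).1 (f x).1 := fun x => by
    simp only [ψ, φ, Equiv.trans_apply, Equiv.apply_symm_apply]
    rfl
  refine ⟨⟨ψ, ?_⟩⟩
  intro x y
  by_cases hxy : x = y
  · subst hxy; simp
  · rw [← adjZ_eq_one, ← adjZ_eq_one, adjZ_oddVectorGraph f (ψ.injective.ne hxy), hψ, hψ, hdot,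
      adjZ_edgeLocalComplement (b := fun x y => (f x).1 ⬝ᵥ (f y).1)
        (fun x y h => adjZ_oddVectorGraph f h) (fun x => (f x).dotProduct_self) huv hxy]

variable [DecidableEq ι]

theorem not_isBipartite_oddVectorGraph {V : Type*} (f : V ≃ OddVector ι)
    (hι : 5 ≤ Fintype.card ι) : ¬ (oddVectorGraph f).IsBipartite := by
  obtain ⟨g⟩ : Nonempty (Fin 5 ↪ ι) :=
    Function.Embedding.nonempty_of_card_le (by simpa using hι)
  have hg : ∀ i j, g i = g j ↔ i = j := fun i j => g.injective.eq_iff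
  let e : Fin 5 → ι → ZMod 2 := fun i => Pi.single (g i) 1
  have he : ∀ i j, e i ⬝ᵥ e j = if i = j then 1 else 0 := fun i j => by
    simp only [e, dotProduct_single, mul_one, Pi.single_apply, hg, eq_comm]
  have hs : ∀ i, ∑ k, e i k = 1 := fun i => by
    rw [← dotProduct_self_zmodTwo, he, if_pos rfl]
  -- Triangle: three odd vectors whose supports pairwise meet exactly in coordinate `g 0`.
  let a : OddVector ι := ⟨e 0, hs 0⟩
  let b : OddVector ι := ⟨e 0 + e 1 + e 2, by
    simp only [Pi.add_apply, Finset.sum_add_distrib, hs]; rfl⟩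
  let c : OddVector ι := ⟨e 0 + e 3 + e 4, by
    simp only [Pi.add_apply, Finset.sum_add_distrib, hs]; rfl⟩
  have hab : a.1 ⬝ᵥ b.1 = 1 := by simp [a, b, dotProduct_add, he]
  have hac : a.1 ⬝ᵥ c.1 = 1 := by simp [a, c, dotProduct_add, he]
  have hbc : b.1 ⬝ᵥ c.1 = 1 := by simp [b, c, dotProduct_add, add_dotProduct, he]
  have h1 : ∀ x y : OddVector ι, (∃ i, x.1 ⬝ᵥ e i ≠ y.1 ⬝ᵥ e i) → f.symm x ≠ f.symm y := by
    rintro x y ⟨i, hi⟩ h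
    exact hi (by rw [f.symm.injective h])
  have nab : f.symm a ≠ f.symm b := h1 _ _ ⟨1, by simp [a, b, add_dotProduct, he]⟩
  have nac : f.symm a ≠ f.symm c := h1 _ _ ⟨3, by simp [a, c, add_dotProduct, he]⟩
  have nbc : f.symm b ≠ f.symm c := h1 _ _ ⟨1, by simp [b, c, add_dotProduct, he]⟩
  rintro ⟨C⟩
  have v1 := C.valid (v := f.symm a) (w := f.symm b) ⟨nab, by simpa using hab⟩
  have v2 := C.valid (v := f.symm a) (w := f.symm c) ⟨nac, by simpa using hac⟩
  have v3 := C.valid (v := f.symm b) (w := f.symm c) ⟨nbc, by simpa using hbc⟩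
  omega

/-- Flipping two coordinates `k`, `l` outside `{i, j}` preserves oddness and the summand, so the
terms cancel in pairs. Four coordinates leave room for `k` and `l`. -/
lemma sum_oddVector_mul (hι : 4 ≤ Fintype.card ι) (i j : ι) :
    ∑ x : OddVector ι, x.1 i * x.1 j = 0 := by
  obtain ⟨k, hk, l, hl, hkl⟩ : ∃ k ∈ ({i, j} : Finset ι)ᶜ, ∃ l ∈ ({i, j} : Finset ι)ᶜ, k ≠ l := by
    apply Finset.one_lt_card.1
    have := Finset.card_le_two (a := i) (b := j)
    rw [Finset.card_compl]
    omega
  simp only [Finset.mem_compl, Finset.mem_insert, Finset.mem_singleton, not_or] at hk hl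
  have hs : ∀ k : ι, ∑ i, (Pi.single k 1 : ι → ZMod 2) i = 1 := fun k => by simp
  have h11 : (1 : ZMod 2) + 1 = 0 := rfl
  refine Finset.sum_involution
    (fun x _ => ⟨x.1 + (Pi.single k 1 + Pi.single l 1), by
      simp only [Pi.add_apply, Finset.sum_add_distrib, hs, x.2, h11, add_zero]⟩)
    ?_ ?_ (fun _ _ => Finset.mem_univ _) ?_
  · intro x _
    simp [Ne.symm hk.1, Ne.symm hk.2, Ne.symm hl.1, Ne.symm hl.2,
      CharTwo.add_self_eq_zero]
  · intro x _ _ h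
    have := congrFun (congrArg Subtype.val h) k
    simp [hkl] at this
  · intro x _
    apply Subtype.ext
    change x.1 + _ + _ = x.1
    rw [add_assoc, add_self_zmodTwo, add_zero]

end OddVector

/-! ### The extended Hamming graph in terms of odd vectors. -/

section Hamming

variable {r : ℕ}

/-- The set of elements of `Fin r` that corresponds to a vertex: empty for the new vertex, a
singleton for the original vertices of the first part. -/
def hammingSupport : Option (HammingVertex r) → Finset (Fin r)
  | none => ∅
  | some (Sum.inl i) => {i}
  | some (Sum.inr s) => s.1

lemma hammingSupport_bijective : Function.Bijective (hammingSupport (r := r)) := by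
  constructor
  · rintro (_ | i | s) (_ | j | t) h <;> simp only [hammingSupport] at h
    · rfl
    · exact absurd h.symm (Finset.singleton_ne_empty j)
    · have := t.2; simp [← h] at this
    · exact absurd h (Finset.singleton_ne_empty i)
    · rw [Finset.singleton_injective h]
    · have := t.2; simp [← h] at this
    · have := s.2; simp [h] at this
    · have := s.2; simp [h] at this
    · rw [Subtype.ext h]
  · intro T
    rcases Nat.lt_or_ge T.card 2 with h | h
    · rcases Nat.lt_or_ge T.card 1 with h | h
      · exact ⟨none, (Finset.card_eq_zero.1 (by omega)).symm⟩
      · obtain ⟨i, rfl⟩ := Finset.card_eq_one.1 (by omega : T.card = 1)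
        exact ⟨some (Sum.inl i), rfl⟩
    · exact ⟨some (Sum.inr ⟨T, h⟩), rfl⟩

/-- The indicator function of `T`, extended by a parity coordinate to an odd vector. -/
def oddIndicator (T : Finset (Fin r)) : OddVector (Option (Fin r)) :=
  ⟨fun k => k.elim (T.card + 1) fun i => if i ∈ T then 1 else 0, by
    simp only [Fintype.sum_option, Option.elim_none, Option.elim_some, Finset.sum_boole,
      Finset.filter_univ_mem]
    rw [add_right_comm, CharTwo.add_self_eq_zero, zero_add]⟩

lemma oddIndicator_bijective : Function.Bijective (oddIndicator (r := r)) := by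
  constructor
  · intro S T h
    ext i
    have := congrFun (congrArg Subtype.val h) (some i)
    clear h
    by_cases h1 : i ∈ S <;> by_cases h2 : i ∈ T <;> simp_all [oddIndicator]
  · intro x
    have hx : ∀ i, (if x.1 (some i) = 1 then (1 : ZMod 2) else 0) = x.1 (some i) := fun i => by
      generalize x.1 (some i) = a
      revert a; decide
    refine ⟨Finset.univ.filter fun i => x.1 (some i) = 1, Subtype.ext (funext ?_)⟩
    rintro (_ | i)
    · have h := x.2
      rw [Fintype.sum_option] at h
      simp only [oddIndicator, Option.elim_none]
      rw [← Finset.sum_boole, Finset.sum_congr rfl fun i _ => hx i]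
      generalize ∑ i, x.1 (some i) = b at *
      generalize x.1 none = a at *
      revert a b; decide
    · simp [oddIndicator, hx]

/-- The vertices of the extended Hamming graph are the odd vectors of length `r + 1`. -/
noncomputable def hammingVector : Option (HammingVertex r) ≃ OddVector (Option (Fin r)) :=
  (Equiv.ofBijective _ hammingSupport_bijective).trans (Equiv.ofBijective _ oddIndicator_bijective)

lemma hammingVector_apply (v : Option (HammingVertex r)) :
    hammingVector v = oddIndicator (hammingSupport v) := rfl

/-- The vertices of the first part. -/
def uVertex (k : Option (Fin r)) : Option (HammingVertex r) := k.map Sum.inl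

/-- The vertices of the second part. -/
def wVertex (s : {s : Finset (Fin r) // 2 ≤ s.card}) : Option (HammingVertex r) :=
  some (Sum.inr s)

lemma eq_uVertex_or_eq_wVertex (v : Option (HammingVertex r)) :
    (∃ k, v = uVertex k) ∨ ∃ s, v = wVertex s := by
  rcases v with _ | i | s
  · exact Or.inl ⟨none, rfl⟩
  · exact Or.inl ⟨some i, rfl⟩
  · exact Or.inr ⟨s, rfl⟩

lemma uVertex_injective : Function.Injective (uVertex (r := r)) :=
  Option.map_injective Sum.inl_injective

lemma wVertex_injective : Function.Injective (wVertex (r := r)) := fun s t h => by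
  simpa [wVertex] using h

lemma uVertex_ne_wVertex (k : Option (Fin r)) (s : {s : Finset (Fin r) // 2 ≤ s.card}) :
    uVertex k ≠ wVertex s := by
  rcases k with _ | i <;> simp [uVertex, wVertex]

lemma extHammingU_eq : extHammingU r = Finset.univ.image uVertex := by
  ext v
  simp [extHammingU, uVertex, Option.exists, eq_comm]

lemma extHammingW_eq : extHammingW r = Finset.univ.image wVertex := rfl

lemma card_extHammingU : (extHammingU r).card = r + 1 := by
  rw [extHammingU_eq, Finset.card_image_of_injective _ uVertex_injective]
  simp

lemma disjoint_extHamming : Disjoint (extHammingU r) (extHammingW r) := by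
  rw [Finset.disjoint_left, extHammingU_eq, extHammingW_eq]
  rintro v hu hw
  obtain ⟨k, -, rfl⟩ := Finset.mem_image.1 hu
  obtain ⟨s, -, h⟩ := Finset.mem_image.1 hw
  exact uVertex_ne_wVertex k s h.symm

lemma union_extHamming : extHammingU r ∪ extHammingW r = Finset.univ := by
  rw [extHammingU_eq, extHammingW_eq, Finset.eq_univ_iff_forall]
  intro v
  rcases eq_uVertex_or_eq_wVertex v with ⟨k, rfl⟩ | ⟨s, rfl⟩ <;> simp

lemma card_extHammingW : (extHammingW r).card + (r + 1) = 2 ^ r := by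
  rw [← card_extHammingU, add_comm, ← Finset.card_union_of_disjoint disjoint_extHamming,
    union_extHamming, Finset.card_univ, Fintype.card_of_bijective hammingSupport_bijective]
  simp

lemma sum_extHammingU {M : Type*} [AddCommMonoid M] (f : Option (HammingVertex r) → M) :
    ∑ v ∈ extHammingU r, f v = ∑ k, f (uVertex k) := by
  rw [extHammingU_eq, Finset.sum_image fun _ _ _ _ h => uVertex_injective h]

lemma sum_extHammingW {M : Type*} [AddCommMonoid M] (f : Option (HammingVertex r) → M) :
    ∑ v ∈ extHammingW r, f v = ∑ s, f (wVertex s) := by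
  rw [extHammingW_eq, Finset.sum_image fun _ _ _ _ h => wVertex_injective h]

lemma hammingVector_uVertex (k : Option (Fin r)) :
    (hammingVector (uVertex k)).1 = Pi.single k 1 := by
  funext l
  rcases k with _ | i <;> rcases l with _ | j <;>
    simp [hammingVector_apply, oddIndicator, uVertex, hammingSupport, Pi.single_apply]
  rfl

/-- The scalar product of two coordinates, taken over the second part. -/
lemma sum_wVertex_mul (hr : 3 ≤ r) (i j : Option (Fin r)) :
    ∑ s, (hammingVector (wVertex s)).1 i * (hammingVector (wVertex s)).1 j =
      if i = j then 1 else 0 := by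
  have h := sum_oddVector_mul (by simpa using hr) i j
  rw [← Equiv.sum_comp (hammingVector (r := r)), ← union_extHamming,
    Finset.sum_union disjoint_extHamming, sum_extHammingU, sum_extHammingW] at h
  -- The sum over all odd vectors is zero, so the part over $W$ equals the part over the unit
  -- vectors.
  have hU : ∑ k, (hammingVector (uVertex k)).1 i * (hammingVector (uVertex k)).1 j =
      if i = j then (1 : ZMod 2) else 0 := by
    simp [hammingVector_uVertex, Pi.single_apply]
  rw [hU] at h
  exact (CharTwo.add_eq_zero.1 h).symm

lemma degree_hammingGraph_inr (s : {s : Finset (Fin r) // 2 ≤ s.card}) :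
    (hammingGraph r).degree (Sum.inr s) = s.1.card := by
  have h : (hammingGraph r).neighborFinset (Sum.inr s) = s.1.map Function.Embedding.inl := by
    ext (i | t) <;> rw [SimpleGraph.mem_neighborFinset] <;> simp [hammingGraph]
  rw [← SimpleGraph.card_neighborFinset_eq_degree, h, Finset.card_map]

/-- Ensures that the new vertex has no neighbour in $U$. Modulo 2, the degree is the diagonal case
of `sum_wVertex_mul`. -/
lemma degree_hammingGraph_inl (hr : 3 ≤ r) (i : Fin r) :
    ¬ Even ((hammingGraph r).degree (Sum.inl i)) := by
  have h : (hammingGraph r).neighborFinset (Sum.inl i) =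
      (Finset.univ.filter fun s : {s : Finset (Fin r) // 2 ≤ s.card} => i ∈ s.1).map
        Function.Embedding.inr := by
    ext (j | t) <;> rw [SimpleGraph.mem_neighborFinset] <;> simp [hammingGraph]
  rw [← ZMod.natCast_eq_zero_iff_even, ← SimpleGraph.card_neighborFinset_eq_degree, h,
    Finset.card_map, ← Finset.sum_boole]
  have h1 := sum_wVertex_mul hr (some i) (some i)
  simp only [zmodTwo_mul_self, if_true] at h1
  rw [show ∑ s : {s : Finset (Fin r) // 2 ≤ s.card}, (if i ∈ s.1 then (1 : ZMod 2) else 0) = 1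
    from h1]
  exact one_ne_zero

lemma adjZ_uVertex_uVertex (hr : 3 ≤ r) (k l : Option (Fin r)) :
    adjZ (extHammingGraph r) (uVertex k) (uVertex l) = 0 := by
  rw [adjZ_eq_zero]
  rcases k with _ | i <;> rcases l with _ | j
  · exact id
  · exact degree_hammingGraph_inl hr j
  · exact degree_hammingGraph_inl hr i
  · exact id

lemma adjZ_wVertex_wVertex (s t : {s : Finset (Fin r) // 2 ≤ s.card}) :
    adjZ (extHammingGraph r) (wVertex s) (wVertex t) = 0 := by
  rw [adjZ_eq_zero]
  exact id

lemma adjZ_uVertex_wVertex (k : Option (Fin r)) (s : {s : Finset (Fin r) // 2 ≤ s.card}) :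
    adjZ (extHammingGraph r) (uVertex k) (wVertex s) = (hammingVector (wVertex s)).1 k := by
  apply zmodTwo_eq_of_iff
  rw [adjZ_eq_one]
  rcases k with _ | i
  -- The parity coordinate is 1 exactly when the set has even size, which is the adjacency rule of
  -- the new vertex.
  · change Even ((hammingGraph r).degree (Sum.inr s)) ↔ (s.1.card : ZMod 2) + 1 = 1
    rw [degree_hammingGraph_inr, add_eq_right, ZMod.natCast_eq_zero_iff_even]
  · change i ∈ s.1 ↔ (if i ∈ s.1 then (1 : ZMod 2) else 0) = 1
    simp

lemma adjZ_wVertex_uVertex (s : {s : Finset (Fin r) // 2 ≤ s.card}) (k : Option (Fin r)) :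
    adjZ (extHammingGraph r) (wVertex s) (uVertex k) = (hammingVector (wVertex s)).1 k := by
  rw [adjZ_comm, adjZ_uVertex_wVertex]

lemma not_adj_of_mem_extHammingU (hr : 3 ≤ r) :
    ∀ u ∈ extHammingU r, ∀ v ∈ extHammingU r, ¬ (extHammingGraph r).Adj u v := by
  simp only [extHammingU_eq, Finset.mem_image, Finset.mem_univ, true_and]
  rintro _ ⟨k, rfl⟩ _ ⟨l, rfl⟩
  exact adjZ_eq_zero.1 (adjZ_uVertex_uVertex hr k l)

lemma not_adj_of_mem_extHammingW :
    ∀ u ∈ extHammingW r, ∀ v ∈ extHammingW r, ¬ (extHammingGraph r).Adj u v := by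
  simp only [extHammingW_eq, Finset.mem_image, Finset.mem_univ, true_and]
  rintro _ ⟨s, rfl⟩ _ ⟨t, rfl⟩
  exact adjZ_eq_zero.1 (adjZ_wVertex_wVertex s t)

theorem isBipartiteWith_extHammingGraph (hr : 3 ≤ r) :
    (extHammingGraph r).IsBipartiteWith (extHammingU r : Set (Option (HammingVertex r)))
      (extHammingW r : Set (Option (HammingVertex r))) := by
  refine ⟨Finset.disjoint_coe.2 disjoint_extHamming, fun v w h => ?_⟩
  have hv : v ∈ extHammingU r ∪ extHammingW r := union_extHamming ▸ Finset.mem_univ v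
  have hw : w ∈ extHammingU r ∪ extHammingW r := union_extHamming ▸ Finset.mem_univ w
  rcases Finset.mem_union.1 hv with hv | hv <;> rcases Finset.mem_union.1 hw with hw | hw
  · exact absurd h (not_adj_of_mem_extHammingU hr v hv w hw)
  · exact Or.inl ⟨hv, hw⟩
  · exact Or.inr ⟨hv, hw⟩
  · exact absurd h (not_adj_of_mem_extHammingW v hv w hw)

theorem localComplementList_extHammingW (hr : 3 ≤ r) {l : List (Option (HammingVertex r))}
    (hl : IsOrdering (extHammingW r) l) :
    localComplementList (extHammingGraph r) l = extHammingGraph r := by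
  refine eq_of_adjZ fun x y hxy => ?_
  rw [adjZ_localComplementList_of_isOrdering not_adj_of_mem_extHammingW hl hxy, sum_extHammingW,
    add_eq_left]
  rcases eq_uVertex_or_eq_wVertex x with ⟨k, rfl⟩ | ⟨s, rfl⟩
  · rcases eq_uVertex_or_eq_wVertex y with ⟨m, rfl⟩ | ⟨t, rfl⟩
    · simp only [adjZ_wVertex_uVertex]
      rw [sum_wVertex_mul hr, if_neg fun h => hxy (congrArg uVertex h)]
    · simp [adjZ_wVertex_wVertex]
  · simp [adjZ_wVertex_wVertex]

theorem localComplementList_extHammingU (hr : 3 ≤ r) {l : List (Option (HammingVertex r))}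
    (hl : IsOrdering (extHammingU r) l) :
    localComplementList (extHammingGraph r) l = oddVectorGraph hammingVector := by
  refine eq_of_adjZ fun x y hxy => ?_
  rw [adjZ_localComplementList_of_isOrdering (not_adj_of_mem_extHammingU hr) hl hxy,
    sum_extHammingU, adjZ_oddVectorGraph _ hxy]
  rcases eq_uVertex_or_eq_wVertex x with ⟨k, rfl⟩ | ⟨s, rfl⟩ <;>
    rcases eq_uVertex_or_eq_wVertex y with ⟨m, rfl⟩ | ⟨t, rfl⟩
  · have hkm : k ≠ m := fun h => hxy (congrArg uVertex h)
    simp [adjZ_uVertex_uVertex hr, hammingVector_uVertex, hkm]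
  · simp [adjZ_uVertex_uVertex hr, hammingVector_uVertex, adjZ_uVertex_wVertex]
  · simp [adjZ_uVertex_uVertex hr, hammingVector_uVertex, adjZ_wVertex_uVertex]
  · simp [adjZ_wVertex_wVertex, adjZ_uVertex_wVertex, dotProduct]

end Hamming

theorem mainTheorem7 (r : ℕ) (hr : 3 ≤ r) :
    ((extHammingGraph r).IsBipartiteWith (extHammingU r : Set (Option (HammingVertex r)))
        (extHammingW r : Set (Option (HammingVertex r))) ∧
      extHammingU r ∪ extHammingW r = Finset.univ ∧
      (extHammingU r).card = r + 1 ∧ (extHammingW r).card + (r + 1) = 2 ^ r) ∧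
    (∀ l : List (Option (HammingVertex r)), IsOrdering (extHammingW r) l →
      localComplementList (extHammingGraph r) l = extHammingGraph r) ∧
    ∃ hStar : SimpleGraph (Option (HammingVertex r)),
      (∀ l : List (Option (HammingVertex r)), IsOrdering (extHammingU r) l →
        localComplementList (extHammingGraph r) l = hStar) ∧
      ELCPreserved hStar ∧
      (4 ≤ r → ¬ hStar.IsBipartite) := by
  refine ⟨⟨isBipartiteWith_extHammingGraph hr, union_extHamming, card_extHammingU,
    card_extHammingW⟩, fun l hl => localComplementList_extHammingW hr hl,
    oddVectorGraph hammingVector, fun l hl => localComplementList_extHammingU hr hl,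
    elcPreserved_oddVectorGraph _, fun h4 => not_isBipartite_oddVectorGraph _ (by simpa using h4)⟩
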